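/- Let $\mathbb{N}$ denote the positive integers and let $f:\mathbb{N}\to\mathbb{N}$ be unbounded and nondecreasing. Suppose that there is $M\in\mathbb{N}$ with $f(Mn)\ge 9f(n)$ for all $n\in\mathbb{N}$. Then there is an elementary amenable lawless group $\Gamma$, generated by a finite set $S$, such that for every $k\ge 2$ the lawlessness growth function $$\mathcal{A}_\Gamma^S(l)=\max_{1\ne w\in F_k,\ |w|\le l}\ \min\Big\{\sum_{i=1}^k|g_i|_S : g_1,\dots,g_k\in\Gamma,\ w(g_1,\dots,g_k)\ne e\Big\}\qquad(l\in\mathbb{N})$$ satisfies $\mathcal{A}_\Gamma^S\approx f$. Moreover $\Gamma$ can be taken to be a sparse wreath product and $S$ its standard generating set. Here a group is lawless if no nontrivial element of a free group of finite rank is killed by all homomorphisms to it; $F_k$ is the free group of rank $k$, $|w|$ is the reduced length of $w$ and $|\cdot|_S$ is the word length in $\Gamma$; $F_1\approx F_2$ means that there is $K\in\mathbb{N}$ with $F_1(l)\le KF_2(Kl)$ and $F_2(l)\le KF_1(Kl)$ for all $l\in\mathbb{N}$. The class of elementary amenable groups is the smallest class of groups that contains all finite groups and $\mathbb{Z}$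 and is closed under subgroups, quotients, extensions and directed limits. A sparse wreath product is a subgroup $\Gamma=\langle\hat g,\hat h,t\rangle$ of an unrestricted wreath product $\Delta^{\mathbb{Z}}\rtimes\langle t\rangle$, $\langle t\rangle\cong\mathbb{Z}$, with standard generating set $\{\hat g,\hat h,t\}$, where $\Delta$ is a group, $\hat g,\hat h\in\Delta^{\mathbb{Z}}$ are given by $\hat g(p(n))=g_{L(n)}$, $\hat h(q(n))=h_{L(n)}$ for $n\in\mathbb{N}$, and are trivial at all other places, for sequences $(g_l)_{l\in\mathbb{N}}$, $(h_l)_{l\in\mathbb{N}}$ in $\Delta$, a nondecreasing unbounded $L:\mathbb{N}\to\mathbb{N}$ and strictly increasing $p,q:\mathbb{N}\to\mathbb{N}\cup\{0\}$ such that $p(1)=q(1)=0$ and, for all $i,j,k,l\in\mathbb{N}$: (a) for $r=p$ and for $r=q$, if $r(j)-r(k)=r(l)-r(i)$, then either $i=k$ and $j=l$, or $j=k$ and $i=l$; (b) if $q(j)-p(k)=q(l)-p(i)$, then $i=k$ and $j=l$. -/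

import Mathlib

universe u

/-! ### Elementary amenable groups -/

/-- The smallest class of groups containing all finite groups and `ℤ` and closed under subgroups
(groups embedding in a member), quotients (homomorphic images), extensions and direct limits of
directed systems. -/
inductive IsElementaryAmenable : (G : Type u) → [Group G] → Prop
  | of_finite (G : Type u) [Group G] [Finite G] : IsElementaryAmenable G
  | of_int (G : Type u) [Group G] (e : Multiplicative ℤ ≃* G) : IsElementaryAmenable G
  | of_injective {G H : Type u} [Group G] [Group H] (φ : H →* G) (hφ : Function.Injective φ)
      (hG : IsElementaryAmenable G) : IsElementaryAmenable H
  | of_surjective {G H : Type u} [Group G] [Group H] (φ : G →* H) (hφ : Function.Surjective φ)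
      (hG : IsElementaryAmenable G) : IsElementaryAmenable H
  | of_extension {G : Type u} [Group G] (N : Subgroup G) [N.Normal]
      (hN : IsElementaryAmenable N) (hQ : IsElementaryAmenable (G ⧸ N)) : IsElementaryAmenable G
  | of_directLimit {ι : Type u} [Preorder ι] [IsDirectedOrder ι] [Nonempty ι]
      (G : ι → Type u) [∀ i, Group (G i)] (φ : ∀ i j, i ≤ j → G i →* G j)
      [DirectedSystem G (φ · · ·)] (hG : ∀ i, IsElementaryAmenable (G i)) :
      IsElementaryAmenable (DirectLimit G φ)

/-! ### Laws and lawlessness growth -/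

/-- The laws of `G` in the free group of rank `k`: the nontrivial words that lie in the kernel of
every homomorphism to `G`. -/
def lawSet (k : ℕ) (G : Type u) [Group G] : Set (FreeGroup (Fin k)) :=
  {w | w ≠ 1 ∧ ∀ π : FreeGroup (Fin k) →* G, π w = 1}

/-- A group is lawless if it has no laws. -/
def IsLawless (G : Type u) [Group G] : Prop :=
  ∀ k : ℕ, lawSet k G = ∅

/-- Word length of `g` with respect to `S`: the least length of an expression of `g` as a product
of elements of `S` and their inverses (`⊤` if there is none). -/
noncomputable def wordLength {G : Type u} [Group G] (S : Set G) (g : G) : ℕ∞ :=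
  ⨅ (l : List G) (_ : (∀ x ∈ l, x ∈ S ∨ x⁻¹ ∈ S) ∧ l.prod = g), (l.length : ℕ∞)

/-- The complexity of the word `w` in `G`: the least total word length of a tuple on which `w`
does not vanish (`⊤` if `w` vanishes identically). -/
noncomputable def complexity {G : Type u} [Group G] (S : Set G) {k : ℕ}
    (w : FreeGroup (Fin k)) : ℕ∞ :=
  ⨅ (g : Fin k → G) (_ : FreeGroup.lift g w ≠ 1), ∑ i, wordLength S (g i)

/-- The lawlessness growth function of `G` with respect to `S`, computed in the free group of
rank `k`: the largest complexity of a nontrivial word of length at most `l`. -/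
noncomputable def lawlessnessGrowth {G : Type u} [Group G] (S : Set G) (k : ℕ) (l : ℕ+) : ℕ∞ :=
  ⨆ (w : FreeGroup (Fin k)) (_ : w ≠ 1 ∧ w.norm ≤ (l : ℕ)), complexity S w

/-- `F₁ ≼ F₂`: for some positive integer `K`, `F₁ l ≤ K * F₂ (K * l)` for all `l`. -/
def GrowthLE (F₁ F₂ : ℕ+ → ℕ∞) : Prop :=
  ∃ K : ℕ+, ∀ l : ℕ+, F₁ l ≤ ((K : ℕ) : ℕ∞) * F₂ (K * l)

/-- Equivalence of growth functions. -/
def GrowthEquiv (F₁ F₂ : ℕ+ → ℕ∞) : Prop :=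
  GrowthLE F₁ F₂ ∧ GrowthLE F₂ F₁

/-! ### Sparse wreath products -/

/-- The data from which a sparse wreath product over `Δ` is built. -/
structure SparseWreathData (Δ : Type u) where
  /-- the sequence `(g_l)` -/
  g : ℕ+ → Δ
  /-- the sequence `(h_l)` -/
  h : ℕ+ → Δ
  /-- the nondecreasing unbounded function `L` -/
  L : ℕ+ → ℕ+
  /-- the positions of the support of `ĝ` -/
  p : ℕ+ → ℕ
  /-- the positions of the support of `ĥ` -/
  q : ℕ+ → ℕ
  L_mono : Monotone L
  L_unbounded : ¬ BddAbove (Set.range L)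
  p_strictMono : StrictMono p
  q_strictMono : StrictMono q
  p_one : p 1 = 0
  q_one : q 1 = 0
  p_sparse : ∀ i j k l : ℕ+, (p j : ℤ) - p k = (p l : ℤ) - p i → (i = k ∧ j = l) ∨ (j = k ∧ i = l)
  q_sparse : ∀ i j k l : ℕ+, (q j : ℤ) - q k = (q l : ℤ) - q i → (i = k ∧ j = l) ∨ (j = k ∧ i = l)
  pq_sparse : ∀ i j k l : ℕ+, (q j : ℤ) - p k = (q l : ℤ) - p i → i = k ∧ j = l

namespace SparseWreathData

variable {Δ : Type u} [Group Δ] (D : SparseWreathData Δ)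

/-- The element `ĝ` of the base group `Δ ^ ℤ` of the unrestricted wreath product: it takes the
value `g (L n)` at `p n` and is trivial elsewhere. -/
noncomputable def gHat : Δ ≀ᵣ Multiplicative ℤ :=
  ⟨Function.extend (fun n : ℕ+ => Multiplicative.ofAdd (D.p n : ℤ)) (fun n => D.g (D.L n)) 1, 1⟩

/-- The element `ĥ` of the base group `Δ ^ ℤ` of the unrestricted wreath product: it takes the
value `h (L n)` at `q n` and is trivial elsewhere. -/
noncomputable def hHat : Δ ≀ᵣ Multiplicative ℤ :=
  ⟨Function.extend (fun n : ℕ+ => Multiplicative.ofAdd (D.q n : ℤ)) (fun n => D.h (D.L n)) 1, 1⟩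

/-- The generating set `{ĝ, ĥ, t}`, where `t` generates the factor `ℤ`. -/
noncomputable def gens : Set (Δ ≀ᵣ Multiplicative ℤ) :=
  {D.gHat, D.hHat, RegularWreathProduct.inl (Multiplicative.ofAdd (1 : ℤ))}

end SparseWreathData

/-- `Γ` with its generating set `S` is (isomorphic to) a sparse wreath product
`⟨ĝ, ĥ, t⟩ ≤ Δ ≀ ℤ` with its generating set `{ĝ, ĥ, t}`. -/
def IsSparseWreathProduct (Γ : Type u) [Group Γ] (S : Set Γ) : Prop :=
  ∃ (Δ : Type u) (_ : Group Δ) (D : SparseWreathData Δ) (e : Γ ≃* Subgroup.closure D.gens),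
    (fun x : Γ => (e x : Δ ≀ᵣ Multiplicative ℤ)) '' S = D.gens

/-!
The group is a sparse wreath product over `Δ = ∏ l, F₂ / F₂^(d l)`, a product of free solvable
groups of rank two, where `g l` and `h l` are the standard generators of the `l`th factor and
`d l` is the least `d` such that `F₂^(d)` has no nontrivial element of length at most `l`. The
positions are `p n = 9 ^ n` and `q n = 3 * 9 ^ n` for `n ≥ 2`, and `L` is the generalized inverse
of `f` with `L n ≤ l ↔ 9 ^ n < f l`.

*Laws of free solvable groups.* The pair `g l, h l` satisfies no relation of length at most `l`.
On the other hand, there is a law of the product of the first `l` factors that has length at most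
`64 * l` (`FreeGroup.exists_mem_derivedSeries_solvableDepth`), because a nontrivial `u` in
`F₂^(m)` gives rise to the nontrivial element `⁅u, s * u * s⁻¹⁆` of the next term, where `s` is a
third letter, and a free group of rank three embeds in `F₂`. That `d l` exists at all is the
residual solvability of free groups (`FreeGroup.eq_one_of_mem_derivedSeries`), which follows by
rewriting a word in terms of the conjugates of its other letters by the powers of one letter.

*Upper bound* (`SolvableSparse.complexity_le`). Conjugating `ĝ` by `t ^ p n` and `ĥ` by `t ^ q n`
brings `g (L n)` and `h (L n)` to the origin, so a word of length `l` does not vanish on these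
conjugates once `L n ≥ l`. The least such `n` satisfies `9 ^ n ≤ 9 * f l` unless `n = 1`. Words in
`k` letters reduce to words in two letters because `⁅a, b⁆, ⁅a ^ 2, b⁆, …` generate a free group
freely.

*Lower bound* (`SolvableSparse.growthLE_lawlessnessGrowth`). The value at `z` of an element of
length `R` only involves the values of `ĝ` and `ĥ` at distance at most `R` from `z`. The positions
grow geometrically, so either only one of them is that near to `z`, or all of those that are lie
within `5 * R` of the origin. In the first case the values at `z` of elements of length `R`
commute. Hence commutators of short elements of the base group have all their values in the
product of the first `l` factors, provided that `5 * R < f l`, and the law of length `64 * l`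
vanishes on such commutators. To have it evaluated on them, commutators of elements of `F₂'` that
freely generate a free group are substituted for its letters.

*Elementary amenability.* By the same argument, the commutator subgroup of the intersection of the
group with the base group is a directed union of solvable groups.
-/

open scoped commutatorElement

/-! ### Wreath products -/

namespace RegularWreathProduct

variable {D Q : Type*} [Group D] [Group Q]

/-- The subgroup of the base group consisting of the functions with values in `H`. -/
def baseSubgroup (Q : Type*) [Group Q] (H : Subgroup D) : Subgroup (D ≀ᵣ Q) where
  carrier := {x | x.right = 1 ∧ ∀ z, x.left z ∈ H}
  one_mem' := ⟨rfl, fun _ => H.one_mem⟩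
  mul_mem' := by
    rintro x y ⟨hx, hx'⟩ ⟨hy, hy'⟩
    exact ⟨by simp [hx, hy], fun z => by simpa [hx] using H.mul_mem (hx' z) (hy' z)⟩
  inv_mem' := by
    rintro x ⟨hx, hx'⟩
    exact ⟨by simp [hx], fun z => by simpa [hx] using hx' z⟩

theorem baseSubgroup_mono {H K : Subgroup D} (h : H ≤ K) : baseSubgroup Q H ≤ baseSubgroup Q K :=
  fun _ hx => ⟨hx.1, fun z => h (hx.2 z)⟩

/-- Evaluation at the place `z`, on the functions with values in `H`. -/
def baseEval (H : Subgroup D) (z : Q) : baseSubgroup Q H →* H where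
  toFun x := ⟨x.1.left z, x.2.2 z⟩
  map_one' := rfl
  map_mul' x y := by ext; simp [x.2.1]

theorem commutator_left {x y : D ≀ᵣ Q} (hx : x.right = 1) (hy : y.right = 1) (z : Q) :
    ⁅x, y⁆.left z = ⁅x.left z, y.left z⁆ := by
  simp [commutatorElement_def, hx, hy]

theorem derivedSeries_baseSubgroup {H : Subgroup D} {n : ℕ} (h : derivedSeries H n = ⊥) :
    derivedSeries (baseSubgroup Q H) n = ⊥ := by
  rw [eq_bot_iff]
  intro x hx
  rw [Subgroup.mem_bot]
  ext z
  · have := map_derivedSeries_le_derivedSeries (f := baseEval H z) n ⟨x, hx, rfl⟩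
    rw [h, Subgroup.mem_bot] at this
    exact congrArg Subtype.val this
  · exact x.2.1

/-- Since `Q` is commutative, the commutator subgroup lies in the base group, where the derived
series is controlled place by place. -/
theorem derivedSeries_succ_le {D Q : Type*} [Group D] [CommGroup Q] (n : ℕ) :
    derivedSeries (D ≀ᵣ Q) (n + 1) ≤ baseSubgroup Q (derivedSeries D n) := by
  induction n with
  | zero =>
    rw [derivedSeries_succ, Subgroup.commutator_le]
    intro x _ y _
    exact ⟨by simp [commutatorElement_def], fun z => Subgroup.mem_top _⟩
  | succ n ih =>
    rw [derivedSeries_succ, Subgroup.commutator_le]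
    intro x hx y hy
    obtain ⟨hx, hx'⟩ := ih hx
    obtain ⟨hy, hy'⟩ := ih hy
    refine ⟨by simp [commutatorElement_def, hx, hy], fun z => ?_⟩
    rw [commutator_left hx hy]
    exact Subgroup.commutator_mem_commutator (hx' z) (hy' z)

/-- Words in elements of the base group are evaluated place by place. -/
theorem lift_left {α : Type*} {x : α → D ≀ᵣ Q} (hx : ∀ a, (x a).right = 1) (w : FreeGroup α)
    (z : Q) : (FreeGroup.lift x w).left z = FreeGroup.lift (fun a => (x a).left z) w := by
  have hx' (a : α) : x a ∈ baseSubgroup Q (⊤ : Subgroup D) := ⟨hx a, fun _ => Subgroup.mem_top _⟩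
  let y (a : α) : baseSubgroup Q (⊤ : Subgroup D) := ⟨x a, hx' a⟩
  have h1 : (baseSubgroup Q (⊤ : Subgroup D)).subtype.comp (FreeGroup.lift y) =
      FreeGroup.lift x := by ext a; all_goals simp [y]
  have h2 : ((⊤ : Subgroup D).subtype.comp (baseEval ⊤ z)).comp (FreeGroup.lift y) =
      FreeGroup.lift fun a => (x a).left z := by ext a; simp [y, baseEval]
  rw [← h1, ← h2]
  rfl

end RegularWreathProduct

/-! ### Lengths and embeddings of free groups -/

namespace FreeGroup

open RegularWreathProduct

variable {α β : Type*} [DecidableEq α] [DecidableEq β]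

theorem norm_commutator_le (x y : FreeGroup α) : ⁅x, y⁆.norm ≤ 2 * x.norm + 2 * y.norm := by
  have h1 := norm_mul_le (x * y * x⁻¹) y⁻¹
  have h2 := norm_mul_le (x * y) x⁻¹
  have h3 := norm_mul_le x y
  rw [norm_inv_eq] at h1 h2
  rw [commutatorElement_def]
  omega

theorem norm_lift_le {φ : α → FreeGroup β} {c : ℕ} (h : ∀ a, (φ a).norm ≤ c) (w : FreeGroup α) :
    (lift φ w).norm ≤ c * w.norm := by
  have key (l : List (α × Bool)) : (lift φ (mk l)).norm ≤ c * l.length := by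
    induction l with
    | nil => simp [← one_eq_mk]
    | cons a l ih =>
      have : mk (a :: l) = mk [a] * mk l := by simp
      rw [this, _root_.map_mul, List.length_cons]
      have h1 : (lift φ (mk [a])).norm ≤ c := by
        obtain ⟨a, _ | _⟩ := a <;> simpa using h a
      linarith [norm_mul_le (lift φ (mk [a])) (lift φ (mk l))]
  simpa [norm, mk_toWord] using key w.toWord

/-- If the places `-e i` are distinct and different from `0`, then the generators `x i` of a free
group sit at these places of an element `b` of a wreath product over `ℤ`, and evaluation at `0`
recovers `x i` from `⁅t ^ e i, b⁆`. -/
theorem lift_commutator_pow_injective {α : Type*} {e : α → ℕ} (he : Function.Injective e)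
    (he0 : ∀ i, e i ≠ 0) :
    Function.Injective
      (lift fun i => ⁅(of 0 : FreeGroup (Fin 2)) ^ e i, (of 1 : FreeGroup (Fin 2))⁆ :
        FreeGroup α →* FreeGroup (Fin 2)) := by
  rw [injective_iff_map_eq_one]
  intro w hw
  let b : Multiplicative ℤ → FreeGroup α :=
    Function.extend (fun i => Multiplicative.ofAdd (-(e i : ℤ))) of 1
  have he' : Function.Injective fun i => Multiplicative.ofAdd (-(e i : ℤ)) := fun i j h =>
    he (by simpa using h)
  have hb (i : α) : b (Multiplicative.ofAdd (-(e i : ℤ))) = of i := he'.extend_apply _ _ i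
  have hb1 : b 1 = 1 := Function.extend_apply' _ _ _ fun ⟨i, hi⟩ => he0 i (by simpa using hi)
  let t : FreeGroup α ≀ᵣ Multiplicative ℤ := inl (Multiplicative.ofAdd 1)
  let x : FreeGroup α ≀ᵣ Multiplicative ℤ := ⟨b, 1⟩
  let ψ : FreeGroup (Fin 2) →* FreeGroup α ≀ᵣ Multiplicative ℤ := lift ![t, x]
  have h1 : ψ.comp (lift fun i => ⁅(of 0 : FreeGroup (Fin 2)) ^ e i, (of 1 : FreeGroup (Fin 2))⁆) =
      lift fun i => ⁅t ^ e i, x⁆ := by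
    apply FreeGroup.ext_hom
    intro i
    simp [ψ, map_commutatorElement]
  have h2 := congrArg ψ hw
  rw [← MonoidHom.comp_apply, h1, _root_.map_one ψ] at h2
  have h3 := lift_left (x := fun i => ⁅t ^ e i, x⁆) (fun i => by
    simp [commutatorElement_def, x]) w 1
  rw [h2] at h3
  have h4 (i : α) : ⁅t ^ e i, x⁆.left 1 = of i := by
    have : b (Multiplicative.ofAdd (1 : ℤ) ^ e i)⁻¹ = of i := by
      rw [← hb i, ← ofAdd_nsmul, nsmul_one, ofAdd_neg]
    simp [commutatorElement_def, t, x, ← _root_.map_pow, this, hb1]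
  simp only [h4] at h3
  exact (lift_of_apply w).symm.trans h3.symm

/-- Commutators with a further letter generate a free group freely: in a wreath product over `ℤ`,
with `x i` at the place `0`, the commutator `⁅x i, t⁆` also has the value `x i` at `0`. -/
theorem lift_commutator_none_injective {α : Type*} :
    Function.Injective
      (lift fun i => ⁅of (some i), of none⁆ : FreeGroup α →* FreeGroup (Option α)) := by
  rw [injective_iff_map_eq_one]
  intro w hw
  let x (i : α) : FreeGroup α ≀ᵣ Multiplicative ℤ := ⟨Pi.mulSingle 1 (of i), 1⟩
  let t : FreeGroup α ≀ᵣ Multiplicative ℤ := inl (Multiplicative.ofAdd 1)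
  let ψ : FreeGroup (Option α) →* FreeGroup α ≀ᵣ Multiplicative ℤ :=
    lift fun o => o.elim t x
  have h1 : ψ.comp (lift fun i => ⁅of (some i), of none⁆) = lift fun i => ⁅x i, t⁆ := by
    apply FreeGroup.ext_hom
    intro i
    simp [ψ, map_commutatorElement]
  have h2 := congrArg ψ hw
  rw [← MonoidHom.comp_apply, h1, _root_.map_one ψ] at h2
  have h3 := lift_left (x := fun i => ⁅x i, t⁆) (fun i => by simp [commutatorElement_def]) w 1
  rw [h2] at h3
  have h4 (i : α) : ⁅x i, t⁆.left 1 = of i := by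
    have : (Multiplicative.ofAdd (1 : ℤ))⁻¹ ≠ 1 := by decide
    simp [commutatorElement_def, x, t, this]
  simp only [h4] at h3
  exact (lift_of_apply w).symm.trans h3.symm

/-- The translation by `u` moves `1` to `u` but fixes a point at infinity. Its conjugate by the
transposition of `u` and this point moves `1` to infinity, so the two do not commute. -/
theorem commutator_conj_none_ne_one {α : Type*} {u : FreeGroup α} (hu : u ≠ 1) :
    ⁅map some u, of none * map some u * (of none)⁻¹⁆ ≠ 1 := by
  classical
  intro h
  let σ : FreeGroup α →* Equiv.Perm (Option (FreeGroup α)) :=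
    { toFun := fun g => Equiv.optionCongr (Equiv.mulLeft g)
      map_one' := by ext x; cases x <;> simp
      map_mul' := fun g h => by ext x; cases x <;> simp [mul_assoc] }
  let π : Equiv.Perm (Option (FreeGroup α)) := Equiv.swap (some u) none
  let ψ : FreeGroup (Option α) →* Equiv.Perm (Option (FreeGroup α)) :=
    lift fun o => o.elim π fun i => σ (of i)
  have h1 : ψ (map some u) = σ u := by
    have : ψ.comp (map some) = σ := by
      apply FreeGroup.ext_hom
      intro i
      simp [ψ]
    rw [← this]; rfl
  have h2 := congrArg ψ h
  rw [map_commutatorElement, _root_.map_one, commutatorElement_eq_one_iff_mul_comm] at h2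
  have h3 := congrArg (fun τ : Equiv.Perm (Option (FreeGroup α)) => τ (some 1)) h2
  have h4 : ψ (of none) = π := by simp [ψ]
  have hu' : (1 : FreeGroup α) ≠ u := hu.symm
  simp [h1, h4, σ, π, Equiv.Perm.mul_apply, Equiv.swap_apply_def, hu'] at h3

end FreeGroup

/-! ### Short elements of the derived series of a free group -/

namespace FreeGroup

open RegularWreathProduct

/-- Rewriting along a letter `x₀`, in wreath product form: `x₀` goes to the translation, and every
other letter `y` to the function whose value at `z` is a generator that stands for the conjugate
`x₀⁻ᶻ * y * x₀ᶻ`. -/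
noncomputable def rewriteHom {α : Type*} [DecidableEq α] (x₀ : α) :
    FreeGroup α →* FreeGroup (α × ℤ) ≀ᵣ Multiplicative ℤ :=
  lift fun y => if y = x₀ then inl (Multiplicative.ofAdd 1) else ⟨fun z => of (y, z.toAdd), 1⟩

section rewriteHom

variable {α : Type*} [DecidableEq α] (x₀ : α)

theorem rewriteHom_of_self : rewriteHom x₀ (of x₀) = inl (Multiplicative.ofAdd 1) := by
  simp [rewriteHom]

theorem rewriteHom_of_ne {y : α} (h : y ≠ x₀) :
    rewriteHom x₀ (of y) = ⟨fun z => of (y, z.toAdd), 1⟩ := by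
  simp [rewriteHom, h]

/-- Substituting the conjugates back recovers the word, up to powers of `x₀` on both sides. -/
theorem lift_rewriteHom_left (w : FreeGroup α) (z : Multiplicative ℤ) :
    lift (fun a : α × ℤ => of x₀ ^ (-a.2) * of a.1 * of x₀ ^ a.2) ((rewriteHom x₀ w).left z) =
      of x₀ ^ (-z.toAdd) * w * of x₀ ^ (z.toAdd - (rewriteHom x₀ w).right.toAdd) := by
  induction w using FreeGroup.induction_on generalizing z with
  | C1 => simp
  | of y =>
    by_cases h : y = x₀
    · subst h
      rw [rewriteHom_of_self]
      simp only [left_inl, right_inl, Pi.one_apply, _root_.map_one, toAdd_ofAdd]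
      group
    · simp [rewriteHom_of_ne x₀ h]
  | inv_of y ih =>
    rw [_root_.map_inv, inv_left, inv_right]
    simp only [Pi.inv_apply, _root_.map_inv, ih]
    simp only [toAdd_mul, toAdd_inv]
    group
  | mul u v hu hv =>
    rw [_root_.map_mul, mul_left, mul_right, Pi.mul_apply, _root_.map_mul, hu, hv]
    simp only [toAdd_mul, toAdd_inv]
    group

theorem norm_rewriteHom_mk_le (l : List (α × Bool)) (z : Multiplicative ℤ) :
    ((rewriteHom x₀ (mk l)).left z).norm ≤ (l.filter fun a => a.1 ≠ x₀).length := by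
  induction l generalizing z with
  | nil => simp [← one_eq_mk]
  | cons a l ih =>
    have : mk (a :: l) = mk [a] * mk l := by simp
    rw [this, _root_.map_mul, mul_left, Pi.mul_apply]
    refine (norm_mul_le _ _).trans ?_
    have h1 : ((rewriteHom x₀ (mk [a])).left z).norm ≤ if a.1 ≠ x₀ then 1 else 0 := by
      have h2 (z) : ((rewriteHom x₀ (of a.1)).left z).norm ≤ if a.1 ≠ x₀ then 1 else 0 := by
        by_cases h : a.1 = x₀
        · simp [h, rewriteHom_of_self]
        · simp [h, rewriteHom_of_ne x₀ h]
      obtain ⟨y, _ | _⟩ := a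
      · have : (mk [(y, false)] : FreeGroup α) = (of y)⁻¹ := rfl
        rw [this, _root_.map_inv, inv_left]
        simpa only [Pi.inv_apply, norm_inv_eq] using h2 _
      · exact h2 z
    have h3 := ih ((rewriteHom x₀ (mk [a])).right⁻¹ * z)
    rw [List.filter_cons]
    by_cases h : a.1 = x₀ <;>
    simp only [h, ne_eq, not_true_eq_false, decide_false, Bool.false_eq_true, if_false,
      not_false_eq_true, decide_true, if_true, List.length_cons] at h1 h3 ⊢ <;> omega

end rewriteHom

/-- Free groups are residually solvable, with a bound: rewriting along the first letter shortens a
word and moves it up one step in the derived series. -/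
theorem eq_one_of_mem_derivedSeries (n : ℕ) {α : Type*} [DecidableEq α] (w : FreeGroup α)
    (hw : w.norm ≤ n) (hw' : w ∈ derivedSeries (FreeGroup α) n) : w = 1 := by
  induction n generalizing α with
  | zero => exact norm_eq_zero.1 (Nat.le_zero.1 hw)
  | succ n ih =>
    cases hl : w.toWord with
    | nil => exact toWord_eq_nil_iff.1 hl
    | cons a l =>
      have hd : rewriteHom a.1 w ∈ baseSubgroup _ (derivedSeries _ n) :=
        derivedSeries_succ_le n
          (map_derivedSeries_le_derivedSeries (f := rewriteHom a.1) _ ⟨w, hw', rfl⟩)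
      have hn : ((rewriteHom a.1 w).left 1).norm ≤ n := by
        have h1 := norm_rewriteHom_mk_le a.1 w.toWord 1
        rw [mk_toWord, hl] at h1
        rw [norm, hl, List.length_cons] at hw
        have h2 := List.length_filter_le (fun b : α × Bool => decide (b.1 ≠ a.1)) l
        simp only [List.filter_cons, ne_eq, not_true_eq_false, decide_false, Bool.false_eq_true,
          if_false] at h1 h2
        omega
      have h3 := lift_rewriteHom_left a.1 w 1
      rw [ih _ hn (hd.2 1), hd.1, _root_.map_one] at h3
      simpa using h3.symm

/-- A nontrivial element of a term of the derived series of the free group of rank two gives one of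
the next term whose length is larger by a constant factor only. -/
theorem exists_mem_derivedSeries_succ {m : ℕ} {u : FreeGroup (Fin 2)} (hu : u ≠ 1)
    (hm : u ∈ derivedSeries (FreeGroup (Fin 2)) m) :
    ∃ v ∈ derivedSeries (FreeGroup (Fin 2)) (m + 1), v ≠ 1 ∧ v.norm ≤ 64 * u.norm := by
  let e : Option (Fin 2) → ℕ := fun o => o.elim 3 fun i => i + 1
  have he : Function.Injective e := by decide
  have he0 : ∀ o, e o ≠ 0 := by decide
  have he3 : ∀ o, e o ≤ 3 := by decide
  let φ : FreeGroup (Option (Fin 2)) →* FreeGroup (Fin 2) :=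
    lift fun i => ⁅(of 0 : FreeGroup (Fin 2)) ^ e i, (of 1 : FreeGroup (Fin 2))⁆
  let u' := map some u
  let v' := ⁅u', of none * u' * (of none)⁻¹⁆
  have hu' : u' ∈ derivedSeries (FreeGroup (Option (Fin 2))) m :=
    map_derivedSeries_le_derivedSeries (f := map some) _ ⟨u, hm, rfl⟩
  have hv' : v' ∈ derivedSeries (FreeGroup (Option (Fin 2))) (m + 1) :=
    Subgroup.commutator_mem_commutator hu' ((derivedSeries_normal _ m).conj_mem _ hu' _)
  refine ⟨φ v', map_derivedSeries_le_derivedSeries (f := φ) _ ⟨v', hv', rfl⟩, ?_, ?_⟩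
  · rw [Ne, ← _root_.map_one φ, (lift_commutator_pow_injective he he0).eq_iff]
    exact commutator_conj_none_ne_one hu
  · have h1 : (φ v').norm ≤ 8 * v'.norm := norm_lift_le (fun o => by
      have h := norm_commutator_le ((of 0 : FreeGroup (Fin 2)) ^ e o) (of 1)
      rw [norm_of_pow, norm_of] at h
      have := he3 o
      omega) v'
    have h2 : u'.norm ≤ 1 * u.norm := by
      change (map some u).norm ≤ _
      rw [map_eq_lift]
      exact norm_lift_le (fun i => (norm_of _).le) u
    have h3 : v'.norm ≤ _ := norm_commutator_le u' (of none * u' * (of none)⁻¹)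
    have h4 := norm_mul_le (of none * u') (of none)⁻¹
    have h5 := norm_mul_le (of none) u'
    rw [norm_inv_eq] at h4
    simp only [norm_of] at h4 h5
    have h6 : u.norm ≠ 0 := mt norm_eq_zero.1 hu
    omega

/-- The least `d` such that the `d`th term of the derived series of the free group of rank two has
no nontrivial element of length at most `l`. -/
noncomputable def solvableDepth (l : ℕ) : ℕ :=
  sInf {d | ∀ w ∈ derivedSeries (FreeGroup (Fin 2)) d, w.norm ≤ l → w = 1}

theorem eq_one_of_mem_derivedSeries_solvableDepth {l : ℕ} {w : FreeGroup (Fin 2)}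
    (hw : w ∈ derivedSeries (FreeGroup (Fin 2)) (solvableDepth l)) (hl : w.norm ≤ l) : w = 1 :=
  Nat.sInf_mem (s := {d | ∀ w ∈ derivedSeries (FreeGroup (Fin 2)) d, w.norm ≤ l → w = 1})
    ⟨l, fun w h h' => eq_one_of_mem_derivedSeries l w h' h⟩ w hw hl

theorem solvableDepth_mono : Monotone solvableDepth := fun _ _ h =>
  Nat.sInf_le fun _ hw hl => eq_one_of_mem_derivedSeries_solvableDepth hw (hl.trans h)

/-- A law of the free solvable group of derived length `solvableDepth l` that is not much longer
than `l`. -/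
theorem exists_mem_derivedSeries_solvableDepth {l : ℕ} (hl : 1 ≤ l) :
    ∃ u ∈ derivedSeries (FreeGroup (Fin 2)) (solvableDepth l), u ≠ 1 ∧ u.norm ≤ 64 * l := by
  cases hd : solvableDepth l with
  | zero =>
    have := eq_one_of_mem_derivedSeries_solvableDepth (l := l) (w := of 0)
      (by rw [hd]; exact Subgroup.mem_top _) (by simpa using hl)
    exact absurd this (of_ne_one _)
  | succ m =>
    have hm : m ∉ {d | ∀ w ∈ derivedSeries (FreeGroup (Fin 2)) d, w.norm ≤ l → w = 1} :=
      Nat.notMem_of_lt_sInf (by change m < solvableDepth l; omega)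
    simp only [Set.mem_ofPred_eq, not_forall] at hm
    obtain ⟨u, hu, hul, hu1⟩ := hm
    obtain ⟨v, hv, hv1, hvl⟩ := exists_mem_derivedSeries_succ hu1 hu
    exact ⟨v, hv, hv1, by omega⟩

end FreeGroup

/-! ### Elementary amenable groups -/

theorem derivedSeries_quotient_derivedSeries (G : Type*) [Group G] (n : ℕ) :
    derivedSeries (G ⧸ derivedSeries G n) n = ⊥ := by
  rw [← map_derivedSeries_eq (QuotientGroup.mk'_surjective (derivedSeries G n)),
    Subgroup.map_eq_bot_iff, QuotientGroup.ker_mk']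

namespace IsElementaryAmenable

theorem of_ker {G Q : Type u} [Group G] [Group Q] (φ : G →* Q)
    (hN : IsElementaryAmenable φ.ker) (hQ : IsElementaryAmenable Q) : IsElementaryAmenable G :=
  of_extension φ.ker hN
    (of_injective (QuotientGroup.kerLift φ) (QuotientGroup.kerLift_injective φ) hQ)

theorem prod {A B : Type u} [Group A] [Group B] (hA : IsElementaryAmenable A)
    (hB : IsElementaryAmenable B) : IsElementaryAmenable (A × B) := by
  refine of_ker (MonoidHom.snd A B) (of_injective ((MonoidHom.fst A B).comp (Subgroup.subtype _))
    ?_ hA) hB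
  rintro ⟨⟨a, b⟩, h⟩ ⟨⟨a', b'⟩, h'⟩ hab
  rw [MonoidHom.mem_ker] at h h'
  exact Subtype.ext (Prod.ext hab (h.trans h'.symm))

/-- A directed union of elementary amenable subgroups is elementary amenable. -/
theorem of_directed_iSup {G : Type u} [Group G] {ι : Type u} [Preorder ι] [IsDirectedOrder ι]
    [Nonempty ι] (H : ι → Subgroup G) (hmono : Monotone H) (hH : ∀ g, ∃ i, g ∈ H i)
    (hEA : ∀ i, IsElementaryAmenable (H i)) : IsElementaryAmenable G := by
  let φ (i j : ι) (h : i ≤ j) : H i →* H j := Subgroup.inclusion (hmono h)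
  have : DirectedSystem (fun i => H i) (φ · · ·) := ⟨fun _ _ => rfl, fun _ _ _ _ _ _ => rfl⟩
  let ψ : DirectLimit (fun i => H i) φ →* G :=
    { toFun := DirectLimit.lift φ (fun i x => (x : G)) fun _ _ _ _ => rfl
      map_one' := DirectLimit.lift_one (f := φ) (fun i => (H i).subtype) fun _ _ _ _ => rfl
      map_mul' := DirectLimit.lift_mul (f := φ) (fun i => (H i).subtype) fun _ _ _ _ => rfl }
  refine of_surjective ψ (fun g => ?_) (of_directLimit (fun i => H i) φ hEA)
  obtain ⟨i, hi⟩ := hH g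
  exact ⟨⟦⟨i, g, hi⟩⟧, rfl⟩

/-- An abelian group is the directed union of its finitely generated subgroups, and these are
obtained from the trivial group by adding one cyclic factor at a time. -/
theorem of_commGroup (G : Type u) [CommGroup G] : IsElementaryAmenable G := by
  classical
  refine of_directed_iSup (fun s : Finset G => Subgroup.closure (s : Set G))
    (fun s t h => Subgroup.closure_mono (by exact_mod_cast h))
    (fun g => ⟨{g}, Subgroup.subset_closure (by simp)⟩) fun s => ?_
  induction s using Finset.induction_on with
  | empty =>
    rw [Finset.coe_empty, Subgroup.closure_empty]
    exact of_finite _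
  | insert a s _ ih =>
    let ψ : Subgroup.closure (s : Set G) × ULift.{u} (Multiplicative ℤ) →* G :=
      (Subgroup.closure (s : Set G)).subtype.coprod
        ((zpowersHom G a).comp (MulEquiv.ulift (α := Multiplicative ℤ)).toMonoidHom)
    have hle : Subgroup.closure ((insert a s : Finset G) : Set G) ≤ ψ.range := by
      rw [Subgroup.closure_le, Finset.coe_insert]
      rintro x (rfl | hx)
      · exact ⟨(1, ULift.up (Multiplicative.ofAdd 1)), (one_mul _).trans (zpow_one x)⟩
      · exact ⟨(⟨x, Subgroup.subset_closure hx⟩, 1), by simp [ψ]⟩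
    exact of_injective (Subgroup.inclusion hle) (Subgroup.inclusion_injective hle)
      (of_surjective ψ.rangeRestrict ψ.rangeRestrict_surjective
        (ih.prod (of_int _ MulEquiv.ulift.symm)))

theorem of_derivedSeries_eq_bot {n : ℕ} {G : Type u} [Group G] (h : derivedSeries G n = ⊥) :
    IsElementaryAmenable G := by
  induction n generalizing G with
  | zero =>
    have : Subsingleton G := Subgroup.subsingleton_iff.1 (subsingleton_of_bot_eq_top h.symm)
    exact of_finite G
  | succ n ih =>
    refine of_extension (derivedSeries G n) ?_ (ih (derivedSeries_quotient_derivedSeries G n))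
    let _ : CommGroup (derivedSeries G n) :=
      { (inferInstance : Group (derivedSeries G n)) with
        mul_comm := fun a b => Subtype.ext <| commutatorElement_eq_one_iff_mul_comm.1 <| by
          rw [← Subgroup.mem_bot, ← h]
          exact Subgroup.commutator_mem_commutator a.2 b.2 }
    exact of_commGroup _

/-- Extensions with an abelian quotient: it is enough to look at the commutator subgroup. -/
theorem of_commutator {G : Type u} [Group G] (h : IsElementaryAmenable (commutator G)) :
    IsElementaryAmenable G :=
  of_extension (commutator G) h (of_commGroup (Abelianization G))

end IsElementaryAmenable

/-! ### Word length -/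

section wordLength

variable {G : Type u} [Group G] {S : Set G}

theorem wordLength_le_iff {g : G} {n : ℕ} : wordLength S g ≤ n ↔
    ∃ l : List G, (∀ x ∈ l, x ∈ S ∨ x⁻¹ ∈ S) ∧ l.prod = g ∧ l.length ≤ n := by
  constructor
  · intro h
    by_contra! hl
    have : ((n + 1 : ℕ) : ℕ∞) ≤ wordLength S g :=
      le_iInf₂ fun l hl' => by exact_mod_cast hl l hl'.1 hl'.2
    have := this.trans h
    norm_cast at this
    omega
  · rintro ⟨l, hl, hg, hn⟩
    exact (iInf₂_le l ⟨hl, hg⟩).trans (by exact_mod_cast hn)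

theorem wordLength_mul_le (g h : G) : wordLength S (g * h) ≤ wordLength S g + wordLength S h := by
  induction hg : wordLength S g with
  | top => simp
  | coe m =>
    induction hh : wordLength S h with
    | top => simp
    | coe n =>
      obtain ⟨l, hl, hlg, hlm⟩ := wordLength_le_iff.1 hg.le
      obtain ⟨k, hk, hkh, hkn⟩ := wordLength_le_iff.1 hh.le
      rw [← Nat.cast_add, wordLength_le_iff]
      refine ⟨l ++ k, fun x hx => ?_, by simp [hlg, hkh], by simp; omega⟩
      exact (List.mem_append.1 hx).elim (hl x) (hk x)

theorem wordLength_inv_le (g : G) : wordLength S g⁻¹ ≤ wordLength S g := by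
  induction hg : wordLength S g with
  | top => simp
  | coe m =>
    obtain ⟨l, hl, hlg, hlm⟩ := wordLength_le_iff.1 hg.le
    rw [wordLength_le_iff]
    refine ⟨(l.map (·⁻¹)).reverse, fun x hx => ?_, by rw [← List.prod_inv_reverse, hlg],
      by simpa using hlm⟩
    simp only [List.mem_reverse, List.mem_map] at hx
    obtain ⟨y, hy, rfl⟩ := hx
    simpa [or_comm] using hl y hy

theorem wordLength_pow_le (g : G) (n : ℕ) : wordLength S (g ^ n) ≤ n * wordLength S g := by
  induction n with
  | zero =>
    simpa using (wordLength_le_iff (S := S) (g := 1) (n := 0)).2 ⟨[], by simp⟩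
  | succ n ih =>
    rw [pow_succ]
    refine (wordLength_mul_le _ _).trans ?_
    rw [Nat.cast_succ, add_mul, one_mul]
    gcongr

theorem wordLength_commutator_le (g h : G) :
    wordLength S ⁅g, h⁆ ≤ 2 * wordLength S g + 2 * wordLength S h := by
  rw [commutatorElement_def]
  calc wordLength S (g * h * g⁻¹ * h⁻¹)
      ≤ wordLength S g + wordLength S h + wordLength S g + wordLength S h := by
        refine (wordLength_mul_le _ _).trans (add_le_add ?_ (wordLength_inv_le h))
        refine (wordLength_mul_le _ _).trans (add_le_add ?_ (wordLength_inv_le g))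
        exact wordLength_mul_le _ _
    _ = 2 * wordLength S g + 2 * wordLength S h := by ring

theorem wordLength_le_one {g : G} (hg : g ∈ S) : wordLength S g ≤ 1 := by
  simpa using (wordLength_le_iff (S := S) (g := g) (n := 1)).2 ⟨[g], by simp [hg]⟩

theorem eq_one_of_wordLength_eq_zero {g : G} (hg : wordLength S g = 0) : g = 1 := by
  obtain ⟨l, _, rfl, h⟩ := (wordLength_le_iff (n := 0)).1 hg.le
  simp [List.length_eq_zero_iff.1 (Nat.le_zero.1 h)]

theorem one_le_complexity {k : ℕ} (w : FreeGroup (Fin k)) : 1 ≤ complexity S w := by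
  refine le_iInf₂ fun g hg => ?_
  rw [Order.one_le_iff_ne_zero]
  intro h
  apply hg
  have : g = 1 := funext fun i =>
    eq_one_of_wordLength_eq_zero ((Finset.sum_eq_zero_iff.1 h) i (Finset.mem_univ i))
  rw [this]
  have : FreeGroup.lift (1 : Fin k → G) = 1 := by ext; simp
  rw [this, MonoidHom.one_apply]

theorem wordLength_ne_top_of_closure_eq_top (hS : Subgroup.closure S = ⊤) (g : G) :
    wordLength S g ≠ ⊤ := by
  induction hS ▸ Subgroup.mem_top g using Subgroup.closure_induction with
  | mem x hx => exact ne_top_of_le_ne_top ENat.one_ne_top (wordLength_le_one hx)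
  | one => exact ne_top_of_le_ne_top ENat.zero_ne_top (wordLength_le_iff (n := 0).2 ⟨[], by simp⟩)
  | mul x y _ _ hx hy =>
    exact ne_top_of_le_ne_top (WithTop.add_ne_top.2 ⟨hx, hy⟩) (wordLength_mul_le x y)
  | inv x _ hx => exact ne_top_of_le_ne_top hx (wordLength_inv_le x)

end wordLength

/-! ### Locality in sparse wreath products -/

namespace SparseWreathData

open RegularWreathProduct

variable {Δ : Type u} [Group Δ]

/-- The subgroup generated by the values of `ĝ` and `ĥ` at the places at distance at most `R` from
`z`. -/
def nearby (D : SparseWreathData Δ) (z : ℤ) (R : ℕ) : Subgroup Δ :=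
  Subgroup.closure ({x | ∃ n, |(D.p n : ℤ) - z| ≤ R ∧ D.g (D.L n) = x} ∪
    {x | ∃ n, |(D.q n : ℤ) - z| ≤ R ∧ D.h (D.L n) = x})

theorem nearby_le_nearby (D : SparseWreathData Δ) {y z : ℤ} {Q R : ℕ} (h : |y - z| + Q ≤ R) :
    D.nearby y Q ≤ D.nearby z R := by
  refine Subgroup.closure_mono (Set.union_subset_union ?_ ?_) <;>
  · rintro x ⟨n, hn, rfl⟩
    refine ⟨n, ?_, rfl⟩
    have := abs_sub_le (a := _) y z |>.trans (add_le_add_left hn _)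
    omega

theorem gHat_left_p (D : SparseWreathData Δ) (n : ℕ+) :
    D.gHat.left (Multiplicative.ofAdd (D.p n : ℤ)) = D.g (D.L n) :=
  Function.Injective.extend_apply (f := fun n : ℕ+ => Multiplicative.ofAdd (D.p n : ℤ))
    (fun i j h => D.p_strictMono.injective (by simpa using h))
    (fun n => D.g (D.L n)) 1 n

theorem hHat_left_q (D : SparseWreathData Δ) (n : ℕ+) :
    D.hHat.left (Multiplicative.ofAdd (D.q n : ℤ)) = D.h (D.L n) :=
  Function.Injective.extend_apply (f := fun n : ℕ+ => Multiplicative.ofAdd (D.q n : ℤ))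
    (fun i j h => D.q_strictMono.injective (by simpa using h))
    (fun n => D.h (D.L n)) 1 n

theorem gHat_left_mem (D : SparseWreathData Δ) (z : Multiplicative ℤ) :
    D.gHat.left z ∈ D.nearby z.toAdd 0 := by
  by_cases h : ∃ n : ℕ+, Multiplicative.ofAdd (D.p n : ℤ) = z
  · obtain ⟨n, rfl⟩ := h
    rw [gHat_left_p]
    exact Subgroup.subset_closure (Or.inl ⟨n, by simp⟩)
  · have : D.gHat.left z = 1 :=
      Function.extend_apply' (fun n : ℕ+ => D.g (D.L n)) (1 : Multiplicative ℤ → Δ) z h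
    rw [this]
    exact Subgroup.one_mem _

theorem hHat_left_mem (D : SparseWreathData Δ) (z : Multiplicative ℤ) :
    D.hHat.left z ∈ D.nearby z.toAdd 0 := by
  by_cases h : ∃ n : ℕ+, Multiplicative.ofAdd (D.q n : ℤ) = z
  · obtain ⟨n, rfl⟩ := h
    rw [hHat_left_q]
    exact Subgroup.subset_closure (Or.inr ⟨n, by simp⟩)
  · have : D.hHat.left z = 1 :=
      Function.extend_apply' (fun n : ℕ+ => D.h (D.L n)) (1 : Multiplicative ℤ → Δ) z h
    rw [this]
    exact Subgroup.one_mem _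

theorem gens_local (D : SparseWreathData Δ) {x : Δ ≀ᵣ Multiplicative ℤ}
    (hx : x ∈ D.gens ∨ x⁻¹ ∈ D.gens) :
    (∀ z, x.left z ∈ D.nearby z.toAdd 0) ∧ |x.right.toAdd| ≤ 1 := by
  have key {y : Δ ≀ᵣ Multiplicative ℤ} (hy : y ∈ D.gens) :
      (∀ z, y.left z ∈ D.nearby z.toAdd 0) ∧ (y.right = 1 ∨ y.left = 1) ∧ |y.right.toAdd| ≤ 1 := by
    obtain rfl | rfl | rfl := hy
    · exact ⟨D.gHat_left_mem, Or.inl rfl, by simp [gHat]⟩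
    · exact ⟨D.hHat_left_mem, Or.inl rfl, by simp [hHat]⟩
    · exact ⟨fun z => Subgroup.one_mem _, Or.inr rfl, by simp⟩
  obtain hx | hx := hx
  · exact ⟨(key hx).1, (key hx).2.2⟩
  · obtain ⟨h1, h2, h3⟩ := key hx
    rw [inv_right, toAdd_inv, abs_neg] at h3
    refine ⟨fun z => ?_, h3⟩
    rw [← inv_inv x, inv_left]
    obtain h2 | h2 := h2
    · simpa [h2] using h1 z
    · simp [h2]

theorem prod_left_mem_nearby (D : SparseWreathData Δ) (l : List (Δ ≀ᵣ Multiplicative ℤ))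
    (hl : ∀ x ∈ l, x ∈ D.gens ∨ x⁻¹ ∈ D.gens) (z : Multiplicative ℤ) :
    l.prod.left z ∈ D.nearby z.toAdd l.length := by
  induction l generalizing z with
  | nil => exact Subgroup.one_mem _
  | cons x l ih =>
    obtain ⟨h1, h2⟩ := D.gens_local (hl x (by simp))
    rw [List.prod_cons, mul_left, Pi.mul_apply, List.length_cons]
    refine Subgroup.mul_mem _ (D.nearby_le_nearby ?_ (h1 z))
      (D.nearby_le_nearby ?_ (ih (fun y hy => hl y (by simp [hy])) (x.right⁻¹ * z)))
    · simp; omega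
    · rw [toAdd_mul, toAdd_inv, neg_add_eq_sub, sub_sub_cancel_left, abs_neg]
      push_cast
      omega

/-- An element of `Γ` of length at most `R` has at `z` a value that only involves the values of `ĝ`
and `ĥ` at distance at most `R` from `z`. -/
theorem left_mem_nearby (D : SparseWreathData Δ) {x : Subgroup.closure D.gens} {R : ℕ}
    (hx : wordLength (Subtype.val ⁻¹' D.gens) x ≤ R) (z : Multiplicative ℤ) :
    x.1.left z ∈ D.nearby z.toAdd R := by
  obtain ⟨l, hl, rfl, hlR⟩ := wordLength_le_iff.1 hx
  have h := D.prod_left_mem_nearby (l.map Subtype.val) (fun y hy => by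
    obtain ⟨y', hy', rfl⟩ := List.mem_map.1 hy
    exact hl y' hy') z
  rw [List.length_map] at h
  rw [← Subgroup.coe_subtype, map_list_prod]
  exact D.nearby_le_nearby (by simpa using hlR) h

end SparseWreathData

/-! ### Geometric positions -/

/-- The positions `0, 9², 9³, …`. -/
def position (n : ℕ+) : ℕ := if n = 1 then 0 else 9 ^ (n : ℕ)

theorem position_one : position 1 = 0 := rfl

theorem position_of_ne {n : ℕ+} (h : n ≠ 1) : position n = 9 ^ (n : ℕ) := if_neg h

theorem position_gap {a b : ℕ+} (h : a < b) : 9 * position a ≤ position b ∧ 0 < position b := by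
  have hb : b ≠ 1 := fun h' => by simp [h'] at h
  rw [position_of_ne hb]
  refine ⟨?_, by positivity⟩
  by_cases ha : a = 1
  · simp [ha, position_one]
  · rw [position_of_ne ha, ← pow_succ']
    exact Nat.pow_le_pow_right (by norm_num) h

theorem position_strictMono : StrictMono position := fun a b h => by
  have := position_gap h
  omega

/-- The positions form a Sidon set. -/
theorem position_sidon {i j k l : ℕ+} (h : position j + position i = position l + position k) :
    (i = k ∧ j = l) ∨ (j = k ∧ i = l) := by
  have gap := @position_gap
  rcases lt_trichotomy i k with h1 | rfl | h1
  · rcases lt_trichotomy j k with h2 | rfl | h2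
    · have := gap h1; have := gap h2; omega
    · exact Or.inr ⟨rfl, position_strictMono.injective (by omega)⟩
    · rcases lt_trichotomy j l with h3 | rfl | h3
      · have := gap h1; have := gap h2; have := gap h3; omega
      · have := gap h1; omega
      · have := gap h1; have := gap h2; have := gap h3; omega
  · exact Or.inl ⟨rfl, position_strictMono.injective (by omega)⟩
  · rcases lt_trichotomy i l with h2 | rfl | h2
    · rcases lt_trichotomy j l with h3 | rfl | h3
      · have := gap h1; have := gap h2; have := gap h3; omega
      · have := gap h1; omega
      · have := gap h1; have := gap h2; have := gap h3; omega
    · exact Or.inr ⟨position_strictMono.injective (by omega), rfl⟩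
    · have := gap h1; have := gap h2; omega

/-- A nonzero difference of positions is never three times another one. -/
theorem position_cross {i j k l : ℕ+}
    (h : 3 * position j + position i = 3 * position l + position k) : i = k ∧ j = l := by
  have gap := @position_gap
  -- By symmetry, it is enough to exclude `j < l`.
  have aux {i j k l : ℕ+} (h : 3 * position j + position i = 3 * position l + position k) :
      ¬ j < l := by
    intro h1
    have h1 := gap h1
    rcases lt_trichotomy i l with h2 | rfl | h2
    · have := gap h2; omega
    · omega
    · rcases lt_trichotomy k i with h3 | rfl | h3
      · have := gap h2; have := gap h3; omega
      · omega
      · have := gap h2; have := gap h3; omega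
  have hjl : j = l := le_antisymm (not_lt.1 (aux h.symm)) (not_lt.1 (aux h))
  subst hjl
  exact ⟨position_strictMono.injective (by omega), rfl⟩

/-- The data of a sparse wreath product with `p n = position n` and `q n = 3 * position n`. -/
def geometricData {Δ : Type*} (g h : ℕ+ → Δ) (L : ℕ+ → ℕ+) (hL : Monotone L)
    (hL' : ¬ BddAbove (Set.range L)) : SparseWreathData Δ where
  g := g
  h := h
  L := L
  p := position
  q n := 3 * position n
  L_mono := hL
  L_unbounded := hL'
  p_strictMono := position_strictMono
  q_strictMono _ _ h := Nat.mul_lt_mul_of_pos_left (position_strictMono h) (by norm_num)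
  p_one := rfl
  q_one := rfl
  p_sparse i j k l h := position_sidon (by omega)
  q_sparse i j k l h := position_sidon (by push_cast at h; omega)
  pq_sparse i j k l h := position_cross (by push_cast at h; omega)

section geometricData

open RegularWreathProduct SparseWreathData

variable {Δ : Type u} [Group Δ] {g h : ℕ+ → Δ} {L : ℕ+ → ℕ+} {hL : Monotone L}
  {hL' : ¬ BddAbove (Set.range L)}

/-- If one of the places that are near to `z` is far out, then it is the only one. -/
theorem nearby_geometricData (K : Subgroup Δ) (R : ℕ)
    (hK : ∀ n, position n ≤ 5 * R → g (L n) ∈ K ∧ h (L n) ∈ K) (z : ℤ) :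
    (geometricData g h L hL hL').nearby z R ≤ K ∨
      ∃ a, (geometricData g h L hL hL').nearby z R ≤ Subgroup.zpowers a := by
  have gap := @position_gap
  by_cases h1 : ∃ n, |(position n : ℤ) - z| ≤ R ∧ 5 * R < position n
  · obtain ⟨n, hn, hn'⟩ := h1
    refine Or.inr ⟨g (L n), (Subgroup.closure_le _).2 (Set.union_subset ?_ ?_)⟩
    · rintro _ ⟨m, hm, rfl⟩
      change |(position m : ℤ) - z| ≤ R at hm
      rcases lt_trichotomy n m with h2 | rfl | h2
      · have := gap h2; rw [abs_le] at hm hn; omega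
      · exact Subgroup.mem_zpowers _
      · have := gap h2; rw [abs_le] at hm hn; omega
    · rintro _ ⟨m, hm, rfl⟩
      change |((3 * position m : ℕ) : ℤ) - z| ≤ R at hm
      rcases lt_trichotomy n m with h2 | rfl | h2
      · have := gap h2; rw [abs_le] at hm hn; omega
      · rw [abs_le] at hm hn; omega
      · have := gap h2; rw [abs_le] at hm hn; omega
  by_cases h1' : ∃ n, |((3 * position n : ℕ) : ℤ) - z| ≤ R ∧ 5 * R < 3 * position n
  · obtain ⟨n, hn, hn'⟩ := h1'
    refine Or.inr ⟨h (L n), (Subgroup.closure_le _).2 (Set.union_subset ?_ ?_)⟩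
    · rintro _ ⟨m, hm, rfl⟩
      change |(position m : ℤ) - z| ≤ R at hm
      rcases lt_trichotomy n m with h2 | rfl | h2
      · have := gap h2; rw [abs_le] at hm hn; omega
      · rw [abs_le] at hm hn; omega
      · have := gap h2; rw [abs_le] at hm hn; omega
    · rintro _ ⟨m, hm, rfl⟩
      change |((3 * position m : ℕ) : ℤ) - z| ≤ R at hm
      rcases lt_trichotomy n m with h2 | rfl | h2
      · have := gap h2; rw [abs_le] at hm hn; omega
      · exact Subgroup.mem_zpowers _
      · have := gap h2; rw [abs_le] at hm hn; omega
  · push Not at h1 h1'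
    refine Or.inl ((Subgroup.closure_le _).2 (Set.union_subset ?_ ?_))
    · rintro _ ⟨m, hm, rfl⟩
      exact (hK m (h1 m hm)).1
    · rintro _ ⟨m, hm, rfl⟩
      exact (hK m (by have := h1' m hm; omega)).2

/-- Commutators of short elements of the base group only see the values of `ĝ` and `ĥ` near to the
origin, because cyclic groups are commutative. -/
theorem commutator_mem_baseSubgroup (K : Subgroup Δ) (R : ℕ)
    (hK : ∀ n, position n ≤ 5 * R → g (L n) ∈ K ∧ h (L n) ∈ K)
    {x y : Subgroup.closure (geometricData g h L hL hL').gens}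
    (hx : wordLength (Subtype.val ⁻¹' (geometricData g h L hL hL').gens) x ≤ R)
    (hy : wordLength (Subtype.val ⁻¹' (geometricData g h L hL hL').gens) y ≤ R)
    (hx' : x.1.right = 1) (hy' : y.1.right = 1) :
    ⁅x.1, y.1⁆ ∈ baseSubgroup (Multiplicative ℤ) K := by
  refine ⟨by simp [commutatorElement_def, hx', hy'], fun z => ?_⟩
  rw [commutator_left hx' hy']
  have hxz := left_mem_nearby _ hx z
  have hyz := left_mem_nearby _ hy z
  obtain hle | ⟨a, hle⟩ := nearby_geometricData (hL := hL) (hL' := hL') K R hK z.toAdd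
  · exact K.commutator_le_self (Subgroup.commutator_mem_commutator (hle hxz) (hle hyz))
  · obtain ⟨m, hm⟩ := hle hxz
    obtain ⟨n, hn⟩ := hle hyz
    have : ⁅x.1.left z, y.1.left z⁆ = 1 := by
      rw [commutatorElement_eq_one_iff_commute, ← hm, ← hn]
      exact (Commute.refl a).zpow_zpow m n
    rw [this]
    exact K.one_mem

end geometricData

/-! ### Free solvable groups at sparse positions -/

section

open RegularWreathProduct SparseWreathData FreeGroup

/-- The product over all `l` of the free solvable groups of rank two and derived length
`solvableDepth l`. -/
abbrev SolvableProduct : Type :=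
  ∀ l : ℕ+, FreeGroup (Fin 2) ⧸ derivedSeries (FreeGroup (Fin 2)) (solvableDepth l)

namespace SolvableProduct

/-- The `i`th standard generator of the `l`th factor. -/
noncomputable def gen (i : Fin 2) (l : ℕ+) : SolvableProduct :=
  Pi.mulSingle l (QuotientGroup.mk (of i))

/-- The product of the first `l` factors. -/
def initial (l : ℕ+) : Subgroup SolvableProduct where
  carrier := {x | ∀ i, l < i → x i = 1}
  one_mem' _ _ := rfl
  mul_mem' hx hy i hi := by simp [hx i hi, hy i hi]
  inv_mem' hx i hi := by simp [hx i hi]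

theorem gen_mem_initial {l m : ℕ+} (h : m ≤ l) (i : Fin 2) : gen i m ∈ initial l :=
  fun _ hj => Pi.mulSingle_eq_of_ne (h.trans_lt hj).ne' _

theorem initial_mono : Monotone initial := fun _ _ h _ hx i hi => hx i (h.trans_lt hi)

theorem derivedSeries_initial (l : ℕ+) :
    derivedSeries (initial l) (solvableDepth l) = ⊥ := by
  rw [eq_bot_iff]
  intro x hx
  rw [Subgroup.mem_bot]
  ext i
  by_cases hi : l < i
  · exact x.2 i hi
  · have h1 := map_derivedSeries_le_derivedSeries
      (f := (Pi.evalMonoidHom _ i).comp (initial l).subtype) _ ⟨x, hx, rfl⟩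
    have h2 := derivedSeries_antitone _ (solvableDepth_mono (not_lt.1 hi)) h1
    exact Subgroup.mem_bot.1 ((derivedSeries_quotient_derivedSeries _ _).le h2)

theorem lift_gen_ne_one {l : ℕ+} {w : FreeGroup (Fin 2)} (hw : w ≠ 1) (hl : w.norm ≤ l) :
    lift (fun i => gen i l) w ≠ 1 := by
  intro h
  have h1 : (Pi.evalMonoidHom _ l).comp (lift fun i => gen i l) = QuotientGroup.mk' _ := by
    apply FreeGroup.ext_hom
    intro i
    simp [gen]
  have h2 := congrArg (Pi.evalMonoidHom _ l) h
  rw [← MonoidHom.comp_apply, h1, _root_.map_one, QuotientGroup.mk'_apply,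
    QuotientGroup.eq_one_iff] at h2
  exact hw (eq_one_of_mem_derivedSeries_solvableDepth h2 hl)

end SolvableProduct

/-- A generalized inverse of `f`: the function `L` with `L n ≤ l ↔ 9 ^ n < f l`. It exceeds `l`
as soon as `9 ^ n` reaches `f l`, but not before. -/
theorem exists_inverse (f : ℕ+ → ℕ+) (hmono : Monotone f) (hunb : ¬ BddAbove (Set.range f)) :
    ∃ L : ℕ+ → ℕ+, (∀ n l, L n ≤ l ↔ 9 ^ (n : ℕ) < (f l : ℕ)) ∧ Monotone L ∧
      ¬ BddAbove (Set.range L) := by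
  have hex (c : ℕ) : ∃ l, c < (f l : ℕ) := by
    by_contra! h
    refine hunb ⟨⟨c + 1, by omega⟩, ?_⟩
    rintro _ ⟨l, rfl⟩
    exact PNat.coe_le_coe _ _ |>.1 ((h l).trans (Nat.le_succ c))
  have hex' (n : ℕ+) : ∃ l, 9 ^ (n : ℕ) < (f l : ℕ) := hex _
  have key (n l : ℕ+) : PNat.find (hex' n) ≤ l ↔ 9 ^ (n : ℕ) < (f l : ℕ) :=
    ⟨fun h => (PNat.find_spec (hex' n)).trans_le (hmono h), fun h => PNat.find_min' _ h⟩
  refine ⟨fun n => PNat.find (hex' n), key, fun m n h => ?_, ?_⟩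
  · exact (key m _).2 ((Nat.pow_le_pow_right (by norm_num) h).trans_lt (PNat.find_spec (hex' n)))
  · rintro ⟨l, hl⟩
    have h1 := (key (f l) l).1 (hl ⟨f l, rfl⟩)
    exact absurd (Nat.lt_pow_self (n := (f l : ℕ)) (by norm_num : 1 < 9)) (by omega)

/-- For `f` and `L` related as in `exists_inverse`, the sparse wreath product data over the free
solvable groups. -/
noncomputable def solvableData {L : ℕ+ → ℕ+} (hL : Monotone L)
    (hL' : ¬ BddAbove (Set.range L)) : SparseWreathData SolvableProduct :=
  geometricData (SolvableProduct.gen 0) (SolvableProduct.gen 1) L hL hL'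

/-- The sparse wreath product over the free solvable groups. -/
abbrev SolvableSparse {L : ℕ+ → ℕ+} (hL : Monotone L) (hL' : ¬ BddAbove (Set.range L)) : Type :=
  Subgroup.closure (solvableData hL hL').gens

/-- The standard generating set `{ĝ, ĥ, t}`, as a subset of the sparse wreath product. -/
def solvableGens {L : ℕ+ → ℕ+} (hL : Monotone L) (hL' : ¬ BddAbove (Set.range L)) :
    Set (SolvableSparse hL hL') :=
  Subtype.val ⁻¹' (solvableData hL hL').gens

namespace SolvableSparse

variable {f L : ℕ+ → ℕ+} {hL : Monotone L} {hL' : ¬ BddAbove (Set.range L)}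

theorem commutator_mem_initial (hfL : ∀ n l, L n ≤ l ↔ 9 ^ (n : ℕ) < (f l : ℕ)) {l : ℕ+} (R : ℕ)
    (hl : 9 < (f l : ℕ)) (hR : 5 * R < (f l : ℕ)) {x y : SolvableSparse hL hL'}
    (hx : wordLength (solvableGens hL hL') x ≤ R) (hy : wordLength (solvableGens hL hL') y ≤ R)
    (hx' : x.1.right = 1) (hy' : y.1.right = 1) :
    ⁅x.1, y.1⁆ ∈ baseSubgroup (Multiplicative ℤ) (SolvableProduct.initial l) := by
  refine commutator_mem_baseSubgroup _ R (fun n hn => ?_) hx hy hx' hy'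
  have : L n ≤ l := by
    rw [hfL]
    by_cases h : n = 1
    · simpa [h] using hl
    · rw [position_of_ne h] at hn
      omega
  exact ⟨SolvableProduct.gen_mem_initial this 0, SolvableProduct.gen_mem_initial this 1⟩

theorem closure_solvableGens : Subgroup.closure (solvableGens hL hL') = ⊤ :=
  Subgroup.closure_closure_coe_preimage

/-- The commutator subgroup of the intersection with the base group is a directed union of solvable
groups: commutators of short elements take their values in `SolvableProduct.initial l`. -/
theorem isElementaryAmenable (hfL : ∀ n l, L n ≤ l ↔ 9 ^ (n : ℕ) < (f l : ℕ))
    (hf' : ¬ BddAbove (Set.range f)) : IsElementaryAmenable (SolvableSparse hL hL') := by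
  let φ : SolvableSparse hL hL' →* Multiplicative ℤ := rightHom.comp (Subgroup.subtype _)
  refine .of_ker φ (.of_commutator ?_) (.of_int _ (MulEquiv.refl _))
  let j : φ.ker →* SolvableProduct ≀ᵣ Multiplicative ℤ :=
    (Subgroup.subtype _).comp (Subgroup.subtype _)
  have hj : Function.Injective j := Subtype.val_injective.comp Subtype.val_injective
  let N (l : ℕ+) : Subgroup φ.ker := (baseSubgroup _ (SolvableProduct.initial l)).comap j
  have hN : Monotone N := fun _ _ h =>
    Subgroup.comap_mono (baseSubgroup_mono (SolvableProduct.initial_mono h))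
  have hle : commutator φ.ker ≤ ⨆ l, N l := by
    rw [commutator_def, Subgroup.commutator_le]
    intro x _ y _
    obtain ⟨m, hm⟩ := ENat.ne_top_iff_exists.1
      (wordLength_ne_top_of_closure_eq_top closure_solvableGens (x : SolvableSparse hL hL'))
    obtain ⟨n, hn⟩ := ENat.ne_top_iff_exists.1
      (wordLength_ne_top_of_closure_eq_top closure_solvableGens (y : SolvableSparse hL hL'))
    obtain ⟨l, hl⟩ : ∃ l, 9 + 5 * (m + n) < (f l : ℕ) := by
      by_contra! h
      refine hf' ⟨⟨9 + 5 * (m + n), by omega⟩, ?_⟩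
      rintro _ ⟨l, rfl⟩
      exact PNat.coe_le_coe _ _ |>.1 (h l)
    refine Subgroup.mem_iSup_of_mem l ?_
    change j ⁅x, y⁆ ∈ baseSubgroup (Multiplicative ℤ) (SolvableProduct.initial l)
    rw [map_commutatorElement]
    exact commutator_mem_initial hfL (m + n) (by omega) (by omega)
      (hm.ge.trans (by exact_mod_cast Nat.le_add_right m n))
      (hn.ge.trans (by exact_mod_cast Nat.le_add_left n m)) x.2 y.2
  refine .of_directed_iSup (fun l => (N l).subgroupOf (commutator φ.ker))
    (fun _ _ h => Subgroup.comap_mono (hN h))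
    (fun x => (Subgroup.mem_iSup_of_directed hN.directed_le).1 (hle x.2)) fun l => ?_
  have hmem (x : (N l).subgroupOf (commutator φ.ker)) :
      j x.1.1 ∈ baseSubgroup (Multiplicative ℤ) (SolvableProduct.initial l) := x.2
  exact .of_injective
    ((j.comp ((Subgroup.subtype _).comp (Subgroup.subtype _))).codRestrict _ hmem)
    (fun x y h => by
      have h' := congrArg Subtype.val h
      exact Subtype.ext (Subtype.ext (hj h')))
    (.of_derivedSeries_eq_bot
      (derivedSeries_baseSubgroup (SolvableProduct.derivedSeries_initial l)))

/-- The translation `t`. -/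
noncomputable def shift (hL : Monotone L) (hL' : ¬ BddAbove (Set.range L)) :
    SolvableSparse hL hL' :=
  ⟨inl (Multiplicative.ofAdd 1), Subgroup.subset_closure (Or.inr (Or.inr rfl))⟩

/-- The element `ĝ`, translated so that its `n`th value sits at the origin. -/
noncomputable def gAt (hL : Monotone L) (hL' : ¬ BddAbove (Set.range L)) (n : ℕ+) :
    SolvableSparse hL hL' :=
  (shift hL hL' ^ position n)⁻¹ * ⟨_, Subgroup.subset_closure (Or.inl rfl)⟩ *
    shift hL hL' ^ position n

/-- The element `ĥ`, translated so that its `n`th value sits at the origin. -/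
noncomputable def hAt (hL : Monotone L) (hL' : ¬ BddAbove (Set.range L)) (n : ℕ+) :
    SolvableSparse hL hL' :=
  (shift hL hL' ^ (3 * position n))⁻¹ * ⟨_, Subgroup.subset_closure (Or.inr (Or.inl rfl))⟩ *
    shift hL hL' ^ (3 * position n)

theorem wordLength_conj_shift_le (x : SolvableSparse hL hL') (hx : x ∈ solvableGens hL hL')
    (m : ℕ) :
    wordLength (solvableGens hL hL') ((shift hL hL' ^ m)⁻¹ * x * shift hL hL' ^ m) ≤
      ((2 * m + 1 : ℕ) : ℕ∞) := by
  have ht : wordLength (solvableGens hL hL') (shift hL hL' ^ m) ≤ m := by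
    refine (wordLength_pow_le _ _).trans ?_
    calc _ ≤ (m : ℕ∞) * 1 := by gcongr; exact wordLength_le_one (Or.inr (Or.inr rfl))
      _ = m := mul_one _
  calc _ ≤ (m : ℕ∞) + 1 + m := by
        refine (wordLength_mul_le _ _).trans (add_le_add ?_ ht)
        refine (wordLength_mul_le _ _).trans (add_le_add ?_ (wordLength_le_one hx))
        exact (wordLength_inv_le _).trans ht
    _ = ((2 * m + 1 : ℕ) : ℕ∞) := by push_cast; ring

theorem conj_shift_left (x : SolvableSparse hL hL') (m : ℕ) :
    ((shift hL hL' ^ m)⁻¹ * x * shift hL hL' ^ m).1.left 1 =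
      x.1.left (Multiplicative.ofAdd (m : ℤ)) := by
  have h : (Multiplicative.ofAdd (1 : ℤ)) ^ m = Multiplicative.ofAdd (m : ℤ) := by
    rw [← ofAdd_nsmul, nsmul_one]
  simp [shift, ← _root_.map_pow, h]

theorem gAt_left (n : ℕ+) : (gAt hL hL' n).1.left 1 = SolvableProduct.gen 0 (L n) :=
  (conj_shift_left _ _).trans ((solvableData hL hL').gHat_left_p n)

theorem hAt_left (n : ℕ+) : (hAt hL hL' n).1.left 1 = SolvableProduct.gen 1 (L n) :=
  (conj_shift_left _ _).trans ((solvableData hL hL').hHat_left_q n)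

/-- Upper bound. An embedding of the free group of rank `k` into that of rank two turns `w` into a
word in two letters. Evaluated on `gAt n` and `hAt n`, its value at the origin is the value on the
generators of a free solvable group, and these satisfy no relation of this length as soon as
`l ≤ L n`. The first such `n` has a position of at most `9 * f l`. -/
theorem complexity_le (hfL : ∀ n l, L n ≤ l ↔ 9 ^ (n : ℕ) < (f l : ℕ)) {k : ℕ}
    {w : FreeGroup (Fin k)} (hw : w ≠ 1) {l : ℕ+} (hl : (2 * k + 2) * w.norm ≤ l) :
    complexity (solvableGens hL hL') w ≤ ((k * (40 * k + 120) * (f l : ℕ) : ℕ) : ℕ∞) := by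
  obtain ⟨n, hn, hpn⟩ : ∃ n, l ≤ L n ∧ position n + 1 ≤ 10 * (f l : ℕ) := by
    have hex : ∃ n, l ≤ L n := by
      by_contra! h
      exact hL' ⟨l, by rintro _ ⟨n, rfl⟩; exact (h n).le⟩
    refine ⟨PNat.find hex, PNat.find_spec hex, ?_⟩
    have hpos := (f l).pos
    by_cases h1 : PNat.find hex = 1
    · rw [h1, position_one]; omega
    · obtain ⟨m, hm⟩ := PNat.exists_eq_succ_of_ne_one h1
      have hlt : L m < l := not_le.1 (PNat.find_min hex (by rw [hm]; exact PNat.lt_add_right m 1))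
      have := (hfL m l).1 hlt.le
      rw [position_of_ne h1, hm, PNat.add_coe, PNat.one_coe, pow_succ]
      omega
  let φ : FreeGroup (Fin k) →* FreeGroup (Fin 2) :=
    lift fun i : Fin k => ⁅(of 0 : FreeGroup (Fin 2)) ^ ((i : ℕ) + 1), (of 1 : FreeGroup (Fin 2))⁆
  have hφ : Function.Injective φ := lift_commutator_pow_injective
    (fun i j h => Fin.ext (by simpa using h)) fun i => Nat.succ_ne_zero _
  have hφw : φ w ≠ 1 := by rwa [Ne, ← _root_.map_one φ, hφ.eq_iff]
  have hφl : (φ w).norm ≤ (2 * k + 2) * w.norm := norm_lift_le (fun i => by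
    have h := norm_commutator_le ((of 0 : FreeGroup (Fin 2)) ^ ((i : ℕ) + 1)) (of 1)
    rw [norm_of_pow, norm_of] at h
    have := i.2
    omega) w
  let ab : Fin 2 → SolvableSparse hL hL' := ![gAt hL hL' n, hAt hL hL' n]
  let x (i : Fin k) : SolvableSparse hL hL' := ⁅gAt hL hL' n ^ ((i : ℕ) + 1), hAt hL hL' n⁆
  have hx : lift x w = lift ab (φ w) := by
    have : (lift ab).comp φ = lift x := by
      apply FreeGroup.ext_hom
      intro i
      simp [φ, x, ab, map_commutatorElement]
    rw [← this]; rfl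
  have hne : lift x w ≠ 1 := by
    rw [hx]
    intro h
    have h1 := lift_left (x := fun i => (ab i).1) (fun i => by
      fin_cases i <;> simp [ab, gAt, hAt, shift, gHat, hHat]) (φ w) 1
    have h2 : (Subgroup.subtype _).comp (lift ab) = lift fun i => (ab i).1 := by
      apply FreeGroup.ext_hom
      intro i
      simp
    have h3 : (fun i => (ab i).1.left 1) = fun i => SolvableProduct.gen i (L n) := by
      funext i
      fin_cases i
      · exact gAt_left n
      · exact hAt_left n
    rw [← h2, h3, MonoidHom.comp_apply, h] at h1
    exact SolvableProduct.lift_gen_ne_one hφw (hφl.trans (hl.trans hn)) h1.symm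
  refine (iInf₂_le x hne).trans ?_
  have hxi (i : Fin k) : wordLength (solvableGens hL hL') (x i) ≤
      (((40 * k + 120) * (f l : ℕ) : ℕ) : ℕ∞) := by
    have hg : wordLength (solvableGens hL hL') (gAt hL hL' n) ≤ ((2 * position n + 1 : ℕ) : ℕ∞) :=
      wordLength_conj_shift_le _ (Or.inl rfl) _
    have hh : wordLength (solvableGens hL hL') (hAt hL hL' n) ≤
        ((2 * (3 * position n) + 1 : ℕ) : ℕ∞) :=
      wordLength_conj_shift_le _ (Or.inr (Or.inl rfl)) _
    calc wordLength (solvableGens hL hL') (x i)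
        ≤ 2 * (((i : ℕ) + 1 : ℕ) * ((2 * position n + 1 : ℕ) : ℕ∞)) +
          2 * ((2 * (3 * position n) + 1 : ℕ) : ℕ∞) := by
          refine (wordLength_commutator_le _ _).trans ?_
          gcongr
          refine (wordLength_pow_le _ _).trans ?_
          gcongr
      _ ≤ (((40 * k + 120) * (f l : ℕ) : ℕ) : ℕ∞) := by
          have h1 := i.2
          have h2 : ((i : ℕ) + 1) * (2 * position n + 1) ≤ k * (2 * position n + 1) :=
            Nat.mul_le_mul_right _ h1
          have h3 : (4 * k + 12) * (position n + 1) ≤ (4 * k + 12) * (10 * (f l : ℕ)) :=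
            Nat.mul_le_mul_left _ hpn
          norm_cast
          nlinarith
  calc ∑ i, wordLength (solvableGens hL hL') (x i)
      ≤ ∑ _i : Fin k, (((40 * k + 120) * (f l : ℕ) : ℕ) : ℕ∞) := Finset.sum_le_sum fun i _ => hxi i
    _ = ((k * (40 * k + 120) * (f l : ℕ) : ℕ) : ℕ∞) := by
        rw [Finset.sum_const, Finset.card_univ, Fintype.card_fin, nsmul_eq_mul, mul_assoc]
        norm_cast

theorem isLawless (hfL : ∀ n l, L n ≤ l ↔ 9 ^ (n : ℕ) < (f l : ℕ)) :
    IsLawless (SolvableSparse hL hL') := by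
  intro k
  rw [Set.eq_empty_iff_forall_notMem]
  rintro w ⟨hw, hlaw⟩
  have h : complexity (solvableGens hL hL') w ≤ _ :=
    complexity_le hfL hw (l := ⟨(2 * k + 2) * w.norm + 1, by omega⟩) (Nat.le_succ _)
  have : complexity (solvableGens hL hL') w = ⊤ := by
    simp [complexity, hlaw]
  rw [this, top_le_iff] at h
  exact ENat.natCast_ne_top _ h

theorem lawlessnessGrowth_growthLE (hfL : ∀ n l, L n ≤ l ↔ 9 ^ (n : ℕ) < (f l : ℕ))
    (k : ℕ) :
    GrowthLE (lawlessnessGrowth (solvableGens hL hL') k) fun n => ((f n : ℕ) : ℕ∞) := by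
  obtain ⟨K, hK⟩ : ∃ K : ℕ+, (K : ℕ) = (k + 1) * (40 * k + 120) := ⟨⟨_, by positivity⟩, rfl⟩
  refine ⟨K, fun l => iSup₂_le fun w hw => (complexity_le hfL hw.1 (l := K * l) ?_).trans ?_⟩
  · rw [PNat.mul_coe, hK]
    exact Nat.mul_le_mul (by nlinarith) hw.2
  · change _ ≤ ((K : ℕ) : ℕ∞) * ((f (K * l) : ℕ) : ℕ∞)
    norm_cast
    exact Nat.mul_le_mul_right _ (le_of_le_of_eq (by nlinarith) hK.symm)

/-- Lower bound. Let `u` be a law of the product of the first `l` factors, and substitute for its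
letters commutators of elements of the commutator subgroup. On tuples of length less than `f l / 40`
the substituted commutators have all their values in the product of the first `l` factors, so that
the resulting word vanishes there. -/
theorem growthLE_lawlessnessGrowth (hfL : ∀ n l, L n ≤ l ↔ 9 ^ (n : ℕ) < (f l : ℕ))
    {k : ℕ} (hk : 2 ≤ k) :
    GrowthLE (fun n => ((f n : ℕ) : ℕ∞)) (lawlessnessGrowth (solvableGens hL hL') k) := by
  refine ⟨2048, fun l => ?_⟩
  obtain ⟨u, hu, hu1, hul⟩ := exists_mem_derivedSeries_solvableDepth l.pos
  -- The substitution `ψ ∘ φ` replaces the `i`th letter of `u` by `⁅⁅a ^ (i + 1), b⁆, ⁅a ^ 3, b⁆⁆`,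
  -- and it is injective.
  let e : Option (Fin 2) → ℕ := fun o => o.elim 3 fun i => i + 1
  have he : Function.Injective e := by decide
  have he0 : ∀ o, e o ≠ 0 := by decide
  have he3 : ∀ o, e o ≤ 3 := by decide
  let φ : FreeGroup (Fin 2) →* FreeGroup (Option (Fin 2)) :=
    lift fun i => ⁅of (some i), of none⁆
  let ψ : FreeGroup (Option (Fin 2)) →* FreeGroup (Fin 2) :=
    lift fun o => ⁅(of 0 : FreeGroup (Fin 2)) ^ e o, (of 1 : FreeGroup (Fin 2))⁆
  let c : Fin 2 → Fin k := Fin.castLE hk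
  let w : FreeGroup (Fin k) := map c (ψ (φ u))
  have hw1 : w ≠ 1 := by
    have h : Function.Injective fun v => map c (ψ (φ v)) :=
      (map_injective (Fin.castLE_injective hk)).comp
        ((lift_commutator_pow_injective he he0).comp lift_commutator_none_injective)
    intro h'
    exact hu1 (h (by simpa [w] using h'))
  have hwl : w.norm ≤ 2048 * l := by
    have h1 : w.norm ≤ 1 * (ψ (φ u)).norm := by
      change (map c (ψ (φ u))).norm ≤ _
      rw [map_eq_lift]
      exact norm_lift_le (fun i => (norm_of _).le) _
    have h2 : (ψ (φ u)).norm ≤ 8 * (φ u).norm := norm_lift_le (fun o => by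
      have h := norm_commutator_le ((of 0 : FreeGroup (Fin 2)) ^ e o) (of 1)
      rw [norm_of_pow, norm_of] at h
      have := he3 o
      omega) _
    have h3 : (φ u).norm ≤ 4 * u.norm := norm_lift_le (fun i => by
      simpa using norm_commutator_le (of (some i)) (of none)) _
    omega
  have hcomp : ((f l : ℕ) : ℕ∞) ≤ 2048 * complexity (solvableGens hL hL') w := by
    by_cases hf9 : (f l : ℕ) ≤ 9
    · calc ((f l : ℕ) : ℕ∞) ≤ 2048 * 1 := by norm_cast; omega
        _ ≤ _ := by gcongr; exact one_le_complexity w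
    -- The largest `R` with `40 * R < f l`.
    obtain ⟨R, hR, hR'⟩ : ∃ R, 40 * R < (f l : ℕ) ∧ (f l : ℕ) ≤ 40 * (R + 1) :=
      ⟨((f l : ℕ) - 1) / 40, by omega, by omega⟩
    have hRc : ((R + 1 : ℕ) : ℕ∞) ≤ complexity (solvableGens hL hL') w := by
      refine le_iInf₂ fun g hg => ?_
      by_contra! hlt
      apply hg
      have hsum : ∑ i, wordLength (solvableGens hL hL') (g i) ≤ R :=
        Order.lt_add_one_iff_of_not_isMax (by simp) |>.1 (by exact_mod_cast hlt)
      have hgi (i : Fin k) : wordLength (solvableGens hL hL') (g i) ≤ R :=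
        (Finset.single_le_sum (fun _ _ => zero_le) (Finset.mem_univ i)).trans hsum
      let x (o : Option (Fin 2)) : SolvableSparse hL hL' := ⁅g (c 0) ^ e o, g (c 1)⁆
      have hx (o : Option (Fin 2)) : wordLength (solvableGens hL hL') (x o) ≤ (8 * R : ℕ) := by
        calc wordLength (solvableGens hL hL') (x o) ≤ 2 * ((3 : ℕ) * R) + 2 * R := by
              refine (wordLength_commutator_le _ _).trans ?_
              gcongr
              · refine (wordLength_pow_le _ _).trans ?_
                gcongr
                · exact he3 o
                · exact hgi _
              · exact hgi _
          _ = (8 * R : ℕ) := by push_cast; ring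
      have hx' (o : Option (Fin 2)) : (x o).1.right = 1 := by
        simp [x, commutatorElement_def]
      let y (i : Fin 2) : baseSubgroup (Multiplicative ℤ) (SolvableProduct.initial l) :=
        ⟨⁅(x (some i)).1, (x none).1⁆, commutator_mem_initial hfL (8 * R) (by omega) (by omega)
          (hx _) (hx _) (hx' _) (hx' _)⟩
      have h1 : lift y u = 1 := by
        have := map_derivedSeries_le_derivedSeries (f := lift y) _ ⟨u, hu, rfl⟩
        rwa [derivedSeries_baseSubgroup (SolvableProduct.derivedSeries_initial l),
          Subgroup.mem_bot] at this
      have h2 : ((Subgroup.subtype _).comp (lift g)).comp ((map c).comp (ψ.comp φ)) =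
          (Subgroup.subtype _).comp (lift y) := by
        apply FreeGroup.ext_hom
        intro i
        simp [φ, ψ, y, x, commutatorElement_def]
      have h3 := congrArg (fun θ => θ u) h2
      simp only [MonoidHom.comp_apply, h1, _root_.map_one] at h3
      exact Subtype.ext h3
    calc ((f l : ℕ) : ℕ∞) ≤ 2048 * ((R + 1 : ℕ) : ℕ∞) := by norm_cast; omega
      _ ≤ _ := by gcongr
  refine hcomp.trans ?_
  change _ ≤ (2048 : ℕ∞) * _
  gcongr
  exact le_iSup₂ (f := fun w (_ : w ≠ 1 ∧ w.norm ≤ ((2048 * l : ℕ+) : ℕ)) =>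
    complexity (solvableGens hL hL') w) w ⟨hw1, hwl⟩

end SolvableSparse

end

theorem theorem4 (f : ℕ+ → ℕ+) (hmono : Monotone f) (hunb : ¬ BddAbove (Set.range f))
    (hf : ∃ M : ℕ+, ∀ n : ℕ+, 9 * f n ≤ f (M * n)) :
    ∃ (Γ : Type) (_ : Group Γ) (S : Set Γ),
      S.Finite ∧ Subgroup.closure S = ⊤ ∧
      IsSparseWreathProduct Γ S ∧
      IsElementaryAmenable Γ ∧
      IsLawless Γ ∧
      ∀ k : ℕ, 2 ≤ k → GrowthEquiv (lawlessnessGrowth S k) (fun n => ((f n : ℕ) : ℕ∞)) := by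
  obtain ⟨L, hfL, hL, hL'⟩ := exists_inverse f hmono hunb
  refine ⟨SolvableSparse hL hL', inferInstance, solvableGens hL hL', ?_,
    SolvableSparse.closure_solvableGens, ⟨SolvableProduct, inferInstance, solvableData hL hL',
      MulEquiv.refl _, ?_⟩, SolvableSparse.isElementaryAmenable hfL hunb,
    SolvableSparse.isLawless hfL, fun k hk =>
      ⟨SolvableSparse.lawlessnessGrowth_growthLE hfL k,
        SolvableSparse.growthLE_lawlessnessGrowth hfL hk⟩⟩
  · exact Set.Finite.preimage Subtype.val_injective.injOn (by simp [SparseWreathData.gens])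
  · exact Subtype.image_preimage_val _ _ |>.trans
      (Set.inter_eq_right.2 Subgroup.subset_closure)
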